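/- Let $d\ge 3$ be an integer and let $T_d$ be the $d$-regular tree, i.e. the infinite connected graph without cycles in which every vertex has exactly $d$ neighbours; write $V(T_d)$ for its vertex set and $\mathrm{Aut}(T_d)$ for its automorphism group, which acts on labellings $f$ of $V(T_d)$ by $(\gamma\cdot f)(s)=f(\gamma^{-1}s)$. Let $A$ be a measurable space, let $Z=(Z_v)_{v\in V(T_d)}$ be independent, identically distributed $A$-valued random variables on a probability space (for example uniform on $[0,1]$), let $M$ be a finite set with the discrete $\sigma$-algebra, and let $Y=F(Z)$ be an $\mathrm{Aut}(T_d)$-factor of the IID process $Z$, that is, $F\colon A^{V(T_d)}\to M^{V(T_d)}$ is measurable and $F(\gamma\cdot z)=\gamma\cdot F(z)$ for all $\gamma\in\mathrm{Aut}(T_d)$ and all $z$. For a finite set $S\subset V(T_d)$ let $H(S)$ denote the Shannon entropy of the joint distribution of $(Y_v)_{v\in S}$. Then for every integer $k\ge 0$, every vertex $o$ and every vertex $v$ of $T_d$, the set $S_k=\{u\in V(T_d) : \mathrm{dist}(o,u)=k\}$ satisfies $$H(S_k)\ \ge\ (d-1)^k\,H(\{v\}).$$ (The values $H(\{v\})$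 and $H(S_k)$ do not depend on the choice of $v$ and $o$.) -/

import Mathlib

open MeasureTheory ProbabilityTheory

noncomputable section

namespace FactorIID

/-- The sphere of radius `k` around `o` in a locally finite connected graph is finite. -/
theorem finite_sphere {V : Type*} (T : SimpleGraph V) [T.LocallyFinite] (hT : T.Connected)
    (o : V) (k : ℕ) : {v : V | T.dist o v = k}.Finite := by
  induction k with
  | zero =>
    refine (Set.finite_singleton o).subset fun v hv => ?_
    exact (hT.dist_eq_zero_iff.mp hv).symm
  | succ k ih =>
    refine (ih.biUnion fun u _ => (T.neighborSet u).toFinite).subset fun v hv => ?_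
    obtain ⟨p, hp⟩ := hT.exists_walk_length_eq_dist v o
    have hv' : T.dist v o = k + 1 := by rw [T.dist_comm]; exact hv
    cases p with
    | nil => simp at hv'
    | @cons _ w _ h q =>
      simp only [SimpleGraph.Walk.length_cons] at hp
      have h1 : T.dist w o ≤ k := (SimpleGraph.dist_le q).trans (by omega)
      have h2 : T.dist v o ≤ T.dist v w + T.dist w o := hT.dist_triangle
      have h3 : T.dist v w ≤ 1 := SimpleGraph.dist_le h.toWalk
      have h4 : T.dist o w = k := by rw [T.dist_comm]; omega
      exact Set.mem_biUnion (x := w) h4 h.symm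

/-- The set `S_k` of vertices at distance `k` from `o`. -/
def sphere {V : Type*} (T : SimpleGraph V) [T.LocallyFinite] (hT : T.Connected)
    (o : V) (k : ℕ) : Finset V :=
  (finite_sphere T hT o k).toFinset

/-- The natural action of an automorphism `γ` on labellings: `(γ · f)(s) = f (γ⁻¹ s)`. -/
def autAct {V A : Type*} {T : SimpleGraph V} (γ : T ≃g T) (f : V → A) : V → A :=
  fun s => f (γ.symm s)

/-- `F : A^V → M^V` is an `Aut(T)`-factor map: measurable for the product σ-algebras and
commuting with the action of every automorphism of `T`. -/
def IsAutFactorMap {V A M : Type*} [MeasurableSpace A] [MeasurableSpace M]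
    (T : SimpleGraph V) (F : (V → A) → (V → M)) : Prop :=
  Measurable F ∧ ∀ (γ : T ≃g T) (z : V → A), F (autAct γ z) = autAct γ (F z)

/-- `Z = (Z_v)` is an IID process: independent, identically distributed random variables. -/
def IsIIDProcess {V A Ω : Type*} [MeasurableSpace A] [MeasurableSpace Ω]
    (P : Measure Ω) (Z : V → Ω → A) : Prop :=
  (∀ v, Measurable (Z v)) ∧ iIndepFun Z P ∧ ∀ u v, IdentDistrib (Z u) (Z v) P P

/-- `Y` is an `Aut(T)`-factor of the process `Z`: `Y = F(Z)` for an `Aut(T)`-factor map `F`. -/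
def IsAutFactorOf {V A M Ω : Type*} [MeasurableSpace A] [MeasurableSpace M]
    (T : SimpleGraph V) (Z : V → Ω → A) (Y : V → Ω → M) : Prop :=
  ∃ F : (V → A) → (V → M), IsAutFactorMap T F ∧ ∀ v ω, Y v ω = F (fun u => Z u ω) v

/-- Shannon entropy `-∑ μ(a) log μ(a)` (with `0 log 0 = 0`) of a distribution on a finite set. -/
def shannonEntropy {α : Type*} [Fintype α] [MeasurableSpace α] (μ : Measure α) : ℝ :=
  ∑ a : α, Real.negMulLog (μ.real {a})

open Classical in
/-- `H(S)`: the entropy of the joint distribution of `Y_v`, `v ∈ S`, for a finite set `S`. -/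
def jointEntropy {V M Ω : Type*} [Fintype M] [MeasurableSpace M] [MeasurableSpace Ω]
    (P : Measure Ω) (Y : V → Ω → M) (S : Finset V) : ℝ :=
  shannonEntropy (P.map fun (ω : Ω) (v : S) => Y v ω)

end FactorIID

end

/-! ### Shannon inequalities for random variables with finitely many values -/

namespace FactorIID

open Real Finset

/-! Replace each seed by a finite-valued observation `W_u` of it, and write `H(S | C)` for the
entropy of `Y_S` given `W_C` (`condEnt`). For a finite `B` and an ordering of `B`, the chain rule
splits `H(S) - H(S | B)` into the informations `I(Y_S ; W_z | W_{before z})`, `z ∈ B`. Since the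
seeds are independent, each such term grows with `S` and with the conditioning set
(`condEnt_sub_insert_le`).

Averaged over all orderings, the term of `z` for a single vertex `u`, with seeds in the ball of
radius `n` around `u`, depends only on `m = dist(u, z)`: the tree is distance-transitive
(`exists_iso_apply_eq`) and the law of the predecessors is equivariant (`sum_before_map`). Call it
`j m`. Then `H(u) - H(u | ball) = ∑ m ≤ n, |S_m| j m`. A vertex `z` with `dist(o, z) = m + k` lies
at distance `m` from some `u ∈ S_k`, so it contributes at least `j m` to `H(S_k)`. As `|S_{m+k}| ≥
(d-1)^k |S_m|`, summing gives `H(S_k) ≥ (d-1)^k (H(v) - H(v | ball))` (`pow_mul_sub_le_of_isTree`).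

Finally `H(v | ball)` can be made arbitrarily small by a fine enough observation and a large enough
ball (`exists_condEnt_pattern_lt`). -/

theorem negMulLog_sum_le {α : Type*} (s : Finset α) (p : α → ℝ) (hp : ∀ a, 0 ≤ p a) :
    negMulLog (∑ a ∈ s, p a) ≤ ∑ a ∈ s, negMulLog (p a) := by
  have h : negMulLog (∑ a ∈ s, p a) = ∑ a ∈ s, -(p a * log (∑ b ∈ s, p b)) := by
    rw [negMulLog, Finset.sum_neg_distrib, ← Finset.sum_mul]; ring
  rw [h]
  refine Finset.sum_le_sum fun a ha => ?_
  rw [negMulLog]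
  rcases (hp a).eq_or_lt with h0 | h0
  · simp [← h0]
  · have : log (p a) ≤ log (∑ b ∈ s, p b) :=
      log_le_log h0 (Finset.single_le_sum (fun b _ => hp b) ha)
    nlinarith

/-- Subadditivity of entropy for an unnormalised joint distribution. -/
theorem sum_negMulLog_add_le {α β : Type*} [Fintype α] [Fintype β] (p : α → β → ℝ)
    (hp : ∀ a b, 0 ≤ p a b) :
    ∑ a, ∑ b, negMulLog (p a b) + negMulLog (∑ a, ∑ b, p a b) ≤
      ∑ a, negMulLog (∑ b, p a b) + ∑ b, negMulLog (∑ a, p a b) := by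
  set s := ∑ a, ∑ b, p a b with hs
  set r : α → ℝ := fun a => ∑ b, p a b with hr
  set c : β → ℝ := fun b => ∑ a, p a b with hc
  have hs' : s = ∑ b, c b := by rw [hs, Finset.sum_comm]
  have hs0 : 0 ≤ s := Finset.sum_nonneg fun a _ => Finset.sum_nonneg fun b _ => hp a b
  -- This is `log x ≤ x - 1` at `x = r a * c b / (s * p a b)`, multiplied by `p a b`. The left sides
  -- sum to zero because `p` and `r c / s` both have total mass `s`.
  have key : ∀ a b, p a b - r a * c b / s ≤
      p a b * log (p a b) + p a b * log s - p a b * log (r a) - p a b * log (c b) := by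
    intro a b
    have hra : p a b ≤ r a := Finset.single_le_sum (fun b _ => hp a b) (Finset.mem_univ b)
    have hcb : p a b ≤ c b :=
      Finset.single_le_sum (f := fun a => p a b) (fun a _ => hp a b) (Finset.mem_univ a)
    rcases (hp a b).eq_or_lt with h0 | h0
    · rw [← h0] at hra hcb ⊢
      have : 0 ≤ r a * c b / s := by positivity
      linarith
    · have h1 : 0 < r a := h0.trans_le hra
      have h2 : 0 < c b := h0.trans_le hcb
      have h3 : r a ≤ s :=
        Finset.single_le_sum (f := r) (fun a _ => Finset.sum_nonneg fun b _ => hp a b)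
          (Finset.mem_univ a)
      have h4 : 0 < s := h1.trans_le h3
      have h5 := Real.log_le_sub_one_of_pos (x := r a * c b / (s * p a b)) (by positivity)
      rw [log_div (by positivity) (by positivity), log_mul h1.ne' h2.ne',
        log_mul h4.ne' h0.ne'] at h5
      have h6 := mul_le_mul_of_nonneg_left h5 h0.le
      have h7 : p a b * (r a * c b / (s * p a b) - 1) = r a * c b / s - p a b := by
        field_simp
      rw [h7] at h6
      linarith
  have hsum : ∑ a, ∑ b, (p a b - r a * c b / s) = 0 := by
    simp only [Finset.sum_sub_distrib]
    rw [← hs]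
    simp_rw [← Finset.sum_div, ← Finset.mul_sum, ← hs', ← Finset.sum_mul]
    change s - s * s / s = 0
    rcases hs0.eq_or_lt with h0 | h0
    · simp [← h0]
    · field_simp; ring
  have hle := Finset.sum_le_sum fun a (_ : a ∈ Finset.univ) =>
    Finset.sum_le_sum fun b (_ : b ∈ Finset.univ) => key a b
  rw [hsum] at hle
  simp only [Finset.sum_sub_distrib, Finset.sum_add_distrib] at hle
  have e1 : ∑ a, ∑ b, p a b * log s = s * log s := by
    simp_rw [← Finset.sum_mul]; rfl
  have e2 : ∑ a, ∑ b, p a b * log (r a) = ∑ a, r a * log (r a) := by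
    simp_rw [← Finset.sum_mul]; rfl
  have e3 : ∑ a, ∑ b, p a b * log (c b) = ∑ b, c b * log (c b) := by
    rw [Finset.sum_comm]; simp_rw [← Finset.sum_mul]; rfl
  rw [e1, e2, e3] at hle
  simp only [negMulLog, neg_mul, Finset.sum_neg_distrib]
  linarith

variable {Ω α β γ : Type*} [MeasurableSpace Ω]

/-- `X` is a simple random variable: its fibres are measurable. -/
def HasMeasurableFibers (X : Ω → α) : Prop := ∀ a, MeasurableSet (X ⁻¹' {a})

/-- Shannon entropy of a random variable with finitely many values. -/
noncomputable def ent [Fintype α] (P : Measure Ω) (X : Ω → α) : ℝ :=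
  ∑ a, negMulLog (P.real (X ⁻¹' {a}))

theorem HasMeasurableFibers.preimage [Finite α] {X : Ω → α} (hX : HasMeasurableFibers X)
    (s : Set α) : MeasurableSet (X ⁻¹' s) := by
  rw [← Set.biUnion_preimage_singleton]
  exact s.toFinite.measurableSet_biUnion fun a _ => hX a

theorem HasMeasurableFibers.comp [Finite α] {X : Ω → α} (hX : HasMeasurableFibers X)
    (f : α → β) : HasMeasurableFibers (fun ω => f (X ω)) :=
  fun b => hX.preimage (f ⁻¹' {b})

theorem HasMeasurableFibers.prodMk {X : Ω → α} {Y : Ω → β} (hX : HasMeasurableFibers X)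
    (hY : HasMeasurableFibers Y) : HasMeasurableFibers (fun ω => (X ω, Y ω)) := by
  rintro ⟨a, b⟩
  convert (hX a).inter (hY b) using 1
  ext ω; simp

theorem HasMeasurableFibers.pi {ι : Type*} [Finite ι] {X : ι → Ω → α}
    (hX : ∀ i, HasMeasurableFibers (X i)) : HasMeasurableFibers (fun ω i => X i ω) := by
  intro a
  convert MeasurableSet.iInter fun i => hX i (a i) using 1
  ext ω; simp [funext_iff]

theorem sum_measureReal_fiber_inter [Fintype α] (P : Measure Ω) [IsProbabilityMeasure P]
    {X : Ω → α} (hX : HasMeasurableFibers X) (E : Set Ω) :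
    ∑ a, P.real (X ⁻¹' {a} ∩ E) = P.real E := by
  simp_rw [← measureReal_restrict_apply (hX _)]
  rw [← measureReal_biUnion_finset _ fun a _ => hX a]
  · have : (⋃ b ∈ Finset.univ, X ⁻¹' {b}) = Set.univ := by ext ω; simp
    rw [this, measureReal_restrict_apply_univ]
  · intro a _ b _ hab
    refine Set.disjoint_left.mpr fun ω h1 h2 => hab ?_
    exact (Set.mem_singleton_iff.mp h1).symm.trans h2

theorem ent_comp_le [Fintype α] [Fintype β] (P : Measure Ω) [IsProbabilityMeasure P]
    {X : Ω → α} (hX : HasMeasurableFibers X) (f : α → β) :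
    ent P (fun ω => f (X ω)) ≤ ent P X := by
  classical
  unfold ent
  rw [← Finset.sum_fiberwise (g := f) (s := Finset.univ)]
  refine Finset.sum_le_sum fun b _ => ?_
  refine le_trans (le_of_eq ?_) (negMulLog_sum_le _ _ fun a => measureReal_nonneg)
  rw [← measureReal_biUnion_finset _ fun a _ => hX a]
  · congr 2; ext ω; simp
  · intro a _ b _ hab
    refine Set.disjoint_left.mpr fun ω h1 h2 => hab ?_
    exact (Set.mem_singleton_iff.mp h1).symm.trans h2

theorem ent_le_of_factorsThrough [Fintype α] [Fintype β] (P : Measure Ω)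
    [IsProbabilityMeasure P] {X : Ω → α} {Y : Ω → β} (hX : HasMeasurableFibers X)
    (h : Y.FactorsThrough X) : ent P Y ≤ ent P X := by
  obtain ⟨ω₀⟩ := nonempty_of_isProbabilityMeasure P
  have := ent_comp_le P hX (Function.extend X Y fun _ => Y ω₀)
  simpa only [h.extend_apply] using this

/-- Entropy sees only the partition into fibres. This identifies tuples with different index types
or repeated entries without building bijections between their value types. -/
theorem ent_congr [Fintype α] [Fintype β] (P : Measure Ω) [IsProbabilityMeasure P]
    {X : Ω → α} {Y : Ω → β} (hX : HasMeasurableFibers X) (hY : HasMeasurableFibers Y)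
    (h : ∀ ω ω', X ω = X ω' ↔ Y ω = Y ω') : ent P X = ent P Y :=
  le_antisymm (ent_le_of_factorsThrough P hY fun ω ω' => (h ω ω').mpr)
    (ent_le_of_factorsThrough P hX fun ω ω' => (h ω ω').mp)

/-- On each event `W = w`, subadditivity applies to the unnormalised law of `(X, Y)` there; the
inequalities are then summed over `w`. -/
theorem ent_submodular [Fintype α] [Fintype β] [Fintype γ] (P : Measure Ω)
    [IsProbabilityMeasure P] {X : Ω → α} {Y : Ω → β} (W : Ω → γ) (hX : HasMeasurableFibers X)
    (hY : HasMeasurableFibers Y) :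
    ent P (fun ω => (W ω, X ω, Y ω)) + ent P W ≤
      ent P (fun ω => (W ω, X ω)) + ent P (fun ω => (W ω, Y ω)) := by
  have e1 : ∀ w x, (fun ω => (W ω, X ω)) ⁻¹' {(w, x)} = X ⁻¹' {x} ∩ W ⁻¹' {w} := by
    intros; ext; simp [and_comm]
  have e2 : ∀ w y, (fun ω => (W ω, Y ω)) ⁻¹' {(w, y)} = Y ⁻¹' {y} ∩ W ⁻¹' {w} := by
    intros; ext; simp [and_comm]
  have e3 : ∀ w x y, (fun ω => (W ω, X ω, Y ω)) ⁻¹' {(w, x, y)} =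
      Y ⁻¹' {y} ∩ (X ⁻¹' {x} ∩ W ⁻¹' {w}) := by
    intros; ext; simp; tauto
  simp only [ent, Fintype.sum_prod_type, ← Finset.sum_add_distrib]
  refine Finset.sum_le_sum fun w _ => ?_
  simp only [e1, e2, e3]
  have h := sum_negMulLog_add_le
    (fun x y => P.real (Y ⁻¹' {y} ∩ (X ⁻¹' {x} ∩ W ⁻¹' {w}))) fun _ _ => measureReal_nonneg
  have e4 : ∀ y, ∑ x, P.real (Y ⁻¹' {y} ∩ (X ⁻¹' {x} ∩ W ⁻¹' {w})) =
      P.real (Y ⁻¹' {y} ∩ W ⁻¹' {w}) := fun y => by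
    simp_rw [Set.inter_left_comm (Y ⁻¹' _)]
    exact sum_measureReal_fiber_inter P hX _
  simpa only [e4, sum_measureReal_fiber_inter P hY, sum_measureReal_fiber_inter P hX] using h

theorem ent_prodMk_of_indepFun [Fintype α] [Fintype β] [MeasurableSpace α] [MeasurableSpace β]
    [MeasurableSingletonClass α] [MeasurableSingletonClass β]
    (P : Measure Ω) [IsProbabilityMeasure P] {X : Ω → α} {Y : Ω → β}
    (hX : HasMeasurableFibers X) (hY : HasMeasurableFibers Y) (h : IndepFun X Y P) :
    ent P (fun ω => (X ω, Y ω)) = ent P X + ent P Y := by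
  have e : ∀ x y, P.real ((fun ω => (X ω, Y ω)) ⁻¹' {(x, y)}) =
      P.real (X ⁻¹' {x}) * P.real (Y ⁻¹' {y}) := by
    intro x y
    have h1 : (fun ω => (X ω, Y ω)) ⁻¹' {(x, y)} = X ⁻¹' {x} ∩ Y ⁻¹' {y} := by
      ext; simp
    rw [h1, measureReal_def, h.measure_inter_preimage_eq_mul _ _ (measurableSet_singleton x)
      (measurableSet_singleton y), ENNReal.toReal_mul]
    rfl
  have s1 : ∑ x, P.real (X ⁻¹' {x}) = 1 := by
    simpa using sum_measureReal_fiber_inter P hX Set.univ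
  have s2 : ∑ y, P.real (Y ⁻¹' {y}) = 1 := by
    simpa using sum_measureReal_fiber_inter P hY Set.univ
  simp only [ent, Fintype.sum_prod_type, e, negMulLog_mul, Finset.sum_add_distrib,
    ← Finset.sum_mul, ← Finset.mul_sum, s1, s2, one_mul]

/-- Joint entropy of the finitely many members `X i`, `i ∈ S`, of a family. -/
noncomputable def famEnt {ι : Type*} [DecidableEq ι] [Fintype α] (P : Measure Ω)
    (X : ι → Ω → α) (S : Finset ι) : ℝ :=
  ent P fun ω (i : S) => X i ω

theorem famEnt_union_add_inter_le {ι : Type*} [DecidableEq ι] [Fintype α] (P : Measure Ω)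
    [IsProbabilityMeasure P] {X : ι → Ω → α} (hX : ∀ i, HasMeasurableFibers (X i))
    (S T : Finset ι) :
    famEnt P X (S ∪ T) + famEnt P X (S ∩ T) ≤ famEnt P X S + famEnt P X T := by
  have hm : ∀ S : Finset ι, HasMeasurableFibers fun ω (i : S) => X i ω :=
    fun S => HasMeasurableFibers.pi fun i => hX i
  have h := ent_submodular P (fun ω (i : ↥(S ∩ T)) => X i ω) (hm S) (hm T)
  have e1 : ent P (fun ω => ((fun i : ↥(S ∩ T) => X i ω), (fun i : S => X i ω),
      fun i : T => X i ω)) = famEnt P X (S ∪ T) := by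
    refine ent_congr P ((hm _).prodMk ((hm _).prodMk (hm _))) (hm _) fun ω ω' => ?_
    simp only [Prod.mk.injEq, funext_iff, Subtype.forall, Finset.mem_inter, Finset.mem_union]
    grind
  have e2 : ent P (fun ω => ((fun i : ↥(S ∩ T) => X i ω), fun i : S => X i ω)) =
      famEnt P X S := by
    refine ent_congr P ((hm _).prodMk (hm _)) (hm _) fun ω ω' => ?_
    simp only [Prod.mk.injEq, funext_iff, Subtype.forall, Finset.mem_inter]
    grind
  have e3 : ent P (fun ω => ((fun i : ↥(S ∩ T) => X i ω), fun i : T => X i ω)) =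
      famEnt P X T := by
    refine ent_congr P ((hm _).prodMk (hm _)) (hm _) fun ω ω' => ?_
    simp only [Prod.mk.injEq, funext_iff, Subtype.forall, Finset.mem_inter]
    grind
  rw [e1, e2, e3] at h
  exact h

theorem famEnt_mono {ι : Type*} [DecidableEq ι] [Fintype α] (P : Measure Ω)
    [IsProbabilityMeasure P] {X : ι → Ω → α} (hX : ∀ i, HasMeasurableFibers (X i))
    {S T : Finset ι} (h : S ⊆ T) : famEnt P X S ≤ famEnt P X T := by
  refine ent_le_of_factorsThrough P (HasMeasurableFibers.pi fun i => hX i) fun ω ω' hω => ?_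
  exact funext fun i => congrFun hω ⟨i, h i.2⟩

theorem famEnt_insert_of_iIndepFun {ι : Type*} [DecidableEq ι] [Fintype α] [MeasurableSpace α]
    [MeasurableSingletonClass α] (P : Measure Ω) [IsProbabilityMeasure P] {X : ι → Ω → α}
    (hX : ∀ i, Measurable (X i)) (hind : iIndepFun X P) {S : Finset ι} {i : ι} (hi : i ∉ S) :
    famEnt P X (insert i S) = famEnt P X S + famEnt P X {i} := by
  have hm : ∀ S : Finset ι, HasMeasurableFibers fun ω (i : S) => X i ω :=
    fun S => HasMeasurableFibers.pi fun i a => hX i (measurableSet_singleton a)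
  unfold famEnt
  rw [← ent_prodMk_of_indepFun P (hm _) (hm _)
    (hind.indepFun_finset S {i} (by simpa using hi) hX)]
  refine ent_congr P (hm _) ((hm _).prodMk (hm _)) fun ω ω' => ?_
  simp only [Prod.mk.injEq, funext_iff, Subtype.forall, Finset.mem_insert,
    Finset.mem_singleton]
  grind

end FactorIID

/-! ### Conditional entropy of the factor given finitely many seeds -/

namespace FactorIID

open Real Finset

section CondEnt

variable {V Ω M K : Type*} [MeasurableSpace Ω] [Fintype M] [Fintype K]

/-- Outputs and seeds are put into one family indexed by `V ⊕ V`, so that the submodularity of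
`famEnt` applies to mixed collections of both. -/
theorem hasMeasurableFibers_sumElim {Y : V → Ω → M} {W : V → Ω → K}
    (hY : ∀ v, HasMeasurableFibers (Y v))
    (hW : ∀ v, HasMeasurableFibers (W v)) (i : V ⊕ V) : HasMeasurableFibers
      (Sum.elim (fun v ω => (Sum.inl (Y v ω) : M ⊕ K)) (fun u ω => Sum.inr (W u ω)) i) := by
  rcases i with v | u
  · exact (hY v).comp Sum.inl
  · exact (hW u).comp Sum.inr

variable [DecidableEq V]

/-- Conditional entropy of `(Y_v)_{v ∈ S}` given `(W_u)_{u ∈ C}`. -/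
noncomputable def condEnt (P : Measure Ω) (Y : V → Ω → M) (W : V → Ω → K) (S C : Finset V) : ℝ :=
  famEnt P (Sum.elim (fun v ω => (Sum.inl (Y v ω) : M ⊕ K)) fun u ω => Sum.inr (W u ω))
    (S.disjSum C) - famEnt P W C

theorem famEnt_comp_measurePreserving {ι : Type*} [DecidableEq ι] (P : Measure Ω)
    {X : ι → Ω → M}
    (hX : ∀ i, HasMeasurableFibers (X i)) {g : Ω → Ω} (hg : MeasurePreserving g P P)
    (S : Finset ι) : famEnt P (fun i ω => X i (g ω)) S = famEnt P X S := by
  unfold famEnt ent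
  refine Finset.sum_congr rfl fun a _ => ?_
  rw [← hg.measureReal_preimage (HasMeasurableFibers.pi (fun i : S => hX i) a).nullMeasurableSet]
  rfl

variable (P : Measure Ω) [IsProbabilityMeasure P] {Y : V → Ω → M} {W : V → Ω → K}

theorem famEnt_sumElim_right (hY : ∀ v, HasMeasurableFibers (Y v))
    (hW : ∀ v, HasMeasurableFibers (W v)) (C : Finset V) :
    famEnt P (Sum.elim (fun v ω => (Sum.inl (Y v ω) : M ⊕ K)) fun u ω => Sum.inr (W u ω))
      ((∅ : Finset V).disjSum C) = famEnt P W C := by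
  refine ent_congr P (HasMeasurableFibers.pi fun i => hasMeasurableFibers_sumElim hY hW i)
    (HasMeasurableFibers.pi fun i => hW i) fun ω ω' => ?_
  simp [funext_iff]

theorem famEnt_sumElim_left (hY : ∀ v, HasMeasurableFibers (Y v))
    (hW : ∀ v, HasMeasurableFibers (W v)) (S : Finset V) :
    famEnt P (Sum.elim (fun v ω => (Sum.inl (Y v ω) : M ⊕ K)) fun u ω => Sum.inr (W u ω))
      (S.disjSum ∅) = famEnt P Y S := by
  refine ent_congr P (HasMeasurableFibers.pi fun i => hasMeasurableFibers_sumElim hY hW i)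
    (HasMeasurableFibers.pi fun i => hY i) fun ω ω' => ?_
  simp [funext_iff]

theorem famEnt_empty {ι : Type*} [DecidableEq ι] (X : ι → Ω → M) : famEnt P X ∅ = 0 := by
  have : ∀ a : ((∅ : Finset ι) → M), (fun ω (i : (∅ : Finset ι)) => X i ω) ⁻¹' {a} = Set.univ :=
    fun a => Set.eq_univ_of_forall fun ω => Subsingleton.elim _ _
  simp [famEnt, ent, this]

theorem condEnt_empty_right (hY : ∀ v, HasMeasurableFibers (Y v))
    (hW : ∀ v, HasMeasurableFibers (W v)) (S : Finset V) :
    condEnt P Y W S ∅ = famEnt P Y S := by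
  rw [condEnt, famEnt_sumElim_left P hY hW, famEnt_empty, sub_zero]

theorem condEnt_nonneg (hY : ∀ v, HasMeasurableFibers (Y v))
    (hW : ∀ v, HasMeasurableFibers (W v)) (S C : Finset V) : 0 ≤ condEnt P Y W S C := by
  rw [condEnt, ← famEnt_sumElim_right P hY hW, sub_nonneg]
  exact famEnt_mono P (hasMeasurableFibers_sumElim hY hW)
    (Finset.disjSum_mono (Finset.empty_subset _) subset_rfl)

theorem condEnt_anti (hY : ∀ v, HasMeasurableFibers (Y v))
    (hW : ∀ v, HasMeasurableFibers (W v)) (S : Finset V) {C C' : Finset V} (h : C ⊆ C') :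
    condEnt P Y W S C' ≤ condEnt P Y W S C := by
  have h1 := famEnt_union_add_inter_le P (hasMeasurableFibers_sumElim hY hW)
    (S.disjSum C) ((∅ : Finset V).disjSum C')
  have e1 : S.disjSum C ∪ (∅ : Finset V).disjSum C' = S.disjSum C' := by
    ext (x | x) <;> simp; grind
  have e2 : S.disjSum C ∩ (∅ : Finset V).disjSum C' = (∅ : Finset V).disjSum C := by
    ext (x | x) <;> simp; grind
  rw [e1, e2, famEnt_sumElim_right P hY hW, famEnt_sumElim_right P hY hW] at h1
  unfold condEnt
  linarith

/-- The two sides are `I(Y_S ; W_z | W_C)` and `I(Y_S' ; W_z | W_C')`. By independence, adding `z`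
raises the entropy of the seeds by `H(W_z)` on both sides. This cancels, and submodularity for `S' ⊔
C'` and `S ⊔ (C ∪ {z})` remains. -/
theorem condEnt_sub_insert_le [MeasurableSpace K] [MeasurableSingletonClass K]
    (hY : ∀ v, HasMeasurableFibers (Y v)) (hW : ∀ v, Measurable (W v))
    (hind : iIndepFun W P) {S S' C C' : Finset V} {z : V} (hS : S ⊆ S') (hC : C ⊆ C')
    (hz : z ∉ C') :
    condEnt P Y W S C - condEnt P Y W S (insert z C) ≤
      condEnt P Y W S' C' - condEnt P Y W S' (insert z C') := by
  have hW' : ∀ v, HasMeasurableFibers (W v) := fun v a => hW v (measurableSet_singleton a)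
  have h1 := famEnt_union_add_inter_le P (hasMeasurableFibers_sumElim hY hW')
    (S'.disjSum C') (S.disjSum (insert z C))
  have e1 : S'.disjSum C' ∪ S.disjSum (insert z C) = S'.disjSum (insert z C') := by
    ext (x | x) <;> simp <;> grind
  have e2 : S'.disjSum C' ∩ S.disjSum (insert z C) = S.disjSum C := by
    ext (x | x) <;> simp <;> grind
  rw [e1, e2] at h1
  have h2 := famEnt_insert_of_iIndepFun P hW hind (fun h => hz (hC h))
  have h3 := famEnt_insert_of_iIndepFun P hW hind hz
  unfold condEnt
  linarith

theorem famEnt_map {ι : Type*} [DecidableEq ι] {X : ι → Ω → M}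
    (hX : ∀ i, HasMeasurableFibers (X i)) (e : ι ↪ ι) (S : Finset ι) :
    famEnt P X (S.map e) = famEnt P (fun i => X (e i)) S := by
  refine ent_congr P (HasMeasurableFibers.pi fun i => hX i)
    (HasMeasurableFibers.pi fun i => hX _) fun ω ω' => ?_
  simp [funext_iff]

/-- Relabelling the vertices by `e` amounts to composing all variables with the measure-preserving
`g`, which leaves every joint law unchanged. -/
theorem condEnt_map (hY : ∀ v, HasMeasurableFibers (Y v))
    (hW : ∀ v, HasMeasurableFibers (W v)) {g : Ω → Ω} (hg : MeasurePreserving g P P)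
    (e : V ↪ V) (hYg : ∀ v ω, Y (e v) ω = Y v (g ω)) (hWg : ∀ v ω, W (e v) ω = W v (g ω))
    (S C : Finset V) : condEnt P Y W (S.map e) (C.map e) = condEnt P Y W S C := by
  have hX := hasMeasurableFibers_sumElim hY hW
  have e1 : (S.map e).disjSum (C.map e) = (S.disjSum C).map (e.sumMap e) := by
    ext (x | x) <;> simp
  unfold condEnt
  rw [e1, famEnt_map P hX, famEnt_map P hW, ← famEnt_comp_measurePreserving P hX hg,
    ← famEnt_comp_measurePreserving P hW hg]
  congr 2
  · ext i ω
    rcases i with v | u <;> simp [hYg, hWg]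
  · ext u ω
    exact hWg u ω

end CondEnt

end FactorIID

/-! ### Approximating the factor by finitely many finite-valued observations -/

namespace FactorIID

open Real Finset

/-- The membership pattern of a point in a finite family of sets. -/
def pattern {A : Type*} (D : Finset (Set A)) (a : A) : D → Prop := fun s => a ∈ (s : Set A)

theorem measurable_pattern {A : Type*} [MeasurableSpace A] {D : Finset (Set A)}
    (hD : ∀ s ∈ D, MeasurableSet s) : Measurable (pattern D) :=
  measurable_pi_lambda _ fun s => (hD s s.2).mem

/-- `E` depends only on the patterns with respect to `D` of the coordinates in `C`. -/
def IsPatternCylinder {V A : Type*} (D : Finset (Set A)) (C : Finset V) (E : Set (V → A)) :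
    Prop :=
  ∀ z z' : V → A, (∀ u ∈ C, pattern D (z u) = pattern D (z' u)) → (z ∈ E ↔ z' ∈ E)

theorem IsPatternCylinder.mono {V A : Type*} {D D' : Finset (Set A)} {C C' : Finset V}
    {E : Set (V → A)} (h : IsPatternCylinder D C E) (hD : D ⊆ D') (hC : C ⊆ C') :
    IsPatternCylinder D' C' E := fun z z' hz => h z z' fun u hu => by
  ext s
  exact iff_of_eq (congrFun (hz u (hC hu)) ⟨s, hD s.2⟩)

theorem hasMeasurableFibers_pattern_tuple {V A : Type*} [MeasurableSpace A]
    {D : Finset (Set A)} (hD : ∀ s ∈ D, MeasurableSet s) (C : Finset V) :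
    HasMeasurableFibers fun (z : V → A) (u : C) => pattern D (z u) :=
  HasMeasurableFibers.pi fun _ _ =>
    (measurable_pattern hD).comp (measurable_pi_apply _) (measurableSet_singleton _)

theorem IsPatternCylinder.measurableSet {V A : Type*} [MeasurableSpace A]
    {D : Finset (Set A)} (hD : ∀ s ∈ D, MeasurableSet s) {C : Finset V} {E : Set (V → A)}
    (h : IsPatternCylinder D C E) : MeasurableSet E := by
  have := (hasMeasurableFibers_pattern_tuple hD C).preimage
    ((fun (z : V → A) (u : C) => pattern D (z u)) '' E)
  convert this using 1
  ext z
  refine ⟨fun hz => ⟨z, hz, rfl⟩, ?_⟩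
  rintro ⟨z', hz', he⟩
  exact (h z' z fun u hu => congrFun he ⟨u, hu⟩).mp hz'

/-- The algebra of all cylinder sets defined by finitely many measurable patterns. -/
def patternCylinders (V A : Type*) [MeasurableSpace A] : Set (Set (V → A)) :=
  {E | ∃ (D : Finset (Set A)) (C : Finset V), (∀ s ∈ D, MeasurableSet s) ∧
    IsPatternCylinder D C E}

theorem isSetAlgebra_patternCylinders (V A : Type*) [MeasurableSpace A] :
    IsSetAlgebra (patternCylinders V A) where
  empty_mem := ⟨∅, ∅, by simp, fun _ _ _ => Iff.rfl⟩
  compl_mem := by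
    rintro E ⟨D, C, hD, h⟩
    exact ⟨D, C, hD, fun z z' hz => not_congr (h z z' hz)⟩
  union_mem := by
    classical
    rintro E E' ⟨D, C, hD, h⟩ ⟨D', C', hD', h'⟩
    refine ⟨D ∪ D', C ∪ C', fun s hs => (Finset.mem_union.mp hs).elim (hD s) (hD' s),
      fun z z' hz => or_congr ?_ ?_⟩
    · exact h.mono Finset.subset_union_left Finset.subset_union_left z z' hz
    · exact h'.mono Finset.subset_union_right Finset.subset_union_right z z' hz

theorem generateFrom_patternCylinders (V A : Type*) [MeasurableSpace A] :
    MeasurableSpace.generateFrom (patternCylinders V A) = MeasurableSpace.pi := by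
  refine le_antisymm (MeasurableSpace.generateFrom_le ?_) (iSup_le fun u => ?_)
  · rintro E ⟨D, C, hD, h⟩
    exact h.measurableSet hD
  · rintro _ ⟨s, hs, rfl⟩
    refine MeasurableSpace.measurableSet_generateFrom
      ⟨{s}, {u}, by simpa using hs, fun z z' hz => ?_⟩
    exact iff_of_eq (congrFun (hz u (by simp)) ⟨s, by simp⟩)

/-- `H(X | X') → 0` as `X'` approximates `X` in probability. -/
theorem exists_ent_prodMk_sub_lt {Ω M : Type*} [MeasurableSpace Ω] [Fintype M] (P : Measure Ω)
    [IsProbabilityMeasure P] {X : Ω → M} (hX : HasMeasurableFibers X) {ε : ℝ} (hε : 0 < ε) :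
    ∃ δ > 0, ∀ X' : Ω → M, HasMeasurableFibers X' → P.real {ω | X' ω ≠ X ω} < δ →
      ent P (fun ω => (X' ω, X ω)) - ent P X' < ε := by
  classical
  -- `Φ` is `H(X', X) - H(X')` as a continuous function of the joint law, and `q` is the law of `(X,
  -- X)`, where it vanishes. Each entry of the law of `(X', X)` differs from that of `q` by at most
  -- the probability of `X' ≠ X`.
  let Φ : (M × M → ℝ) → ℝ := fun p =>
    ∑ m', ∑ m, negMulLog (p (m', m)) - ∑ m', negMulLog (∑ m, p (m', m))
  have hΦ : Continuous Φ := by fun_prop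
  let q : M × M → ℝ := fun x => if x.1 = x.2 then P.real (X ⁻¹' {x.1}) else 0
  have hq : Φ q = 0 := by
    simp [Φ, q, apply_ite negMulLog]
  obtain ⟨δ, hδ, h⟩ := Metric.continuous_iff.mp hΦ q ε hε
  refine ⟨δ, hδ, fun X' hX' hlt => ?_⟩
  let p : M × M → ℝ := fun x => P.real ((fun ω => (X' ω, X ω)) ⁻¹' {x})
  have hpre : ∀ a b, (fun ω => (X' ω, X ω)) ⁻¹' {(a, b)} = X ⁻¹' {b} ∩ X' ⁻¹' {a} := by
    intro a b; ext; simp [and_comm]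
  have hent : ent P (fun ω => (X' ω, X ω)) - ent P X' = Φ p := by
    simp only [ent, Φ, p, Fintype.sum_prod_type, hpre, sum_measureReal_fiber_inter P hX]
  have hdist : dist p q < δ := by
    refine (dist_pi_lt_iff hδ).mpr ?_
    rintro ⟨a, b⟩
    rw [Real.dist_eq]
    refine lt_of_le_of_lt ?_ hlt
    simp only [p, q, hpre]
    split_ifs with hab
    · subst hab
      refine (abs_measureReal_sub_le_measureReal_symmDiff ((hX a).inter (hX' a)).nullMeasurableSet
        (hX a).nullMeasurableSet).trans ?_
      refine measureReal_mono fun ω hω => ?_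
      simp only [Set.mem_symmDiff, Set.mem_inter_iff, Set.mem_preimage, Set.mem_singleton_iff,
        Set.mem_ofPred_eq] at hω ⊢
      grind
    · rw [sub_zero, abs_of_nonneg measureReal_nonneg]
      refine measureReal_mono fun ω hω => ?_
      simp only [Set.mem_inter_iff, Set.mem_preimage, Set.mem_singleton_iff,
        Set.mem_ofPred_eq] at hω ⊢
      grind
  have := h p hdist
  rw [hq, dist_zero_right, Real.norm_eq_abs] at this
  rw [hent]
  exact (le_abs_self _).trans_lt this

/-- Each fibre of `X` is approximated by a cylinder `E m` up to measure `δ / |M|`, and `X'` is read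
off from the set of `m` with `z ∈ E m`. -/
theorem exists_isPatternCylinder_approx {V A M : Type*} [MeasurableSpace A] [Fintype M]
    (μ : Measure (V → A)) [IsProbabilityMeasure μ] {X : (V → A) → M}
    (hX : HasMeasurableFibers X) {δ : ℝ} (hδ : 0 < δ) :
    ∃ (D : Finset (Set A)) (C : Finset V) (X' : (V → A) → M), (∀ s ∈ D, MeasurableSet s) ∧
      X'.FactorsThrough (fun z (u : C) => pattern D (z u)) ∧ HasMeasurableFibers X' ∧
      μ.real {z | X' z ≠ X z} < δ := by
  classical
  obtain ⟨z₀⟩ := nonempty_of_isProbabilityMeasure μ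
  have hM : 0 < (Fintype.card M : ℝ) := by
    exact_mod_cast Fintype.card_pos_iff.mpr ⟨X z₀⟩
  have hdense := Measure.MeasureDense.of_generateFrom_isSetAlgebra_finite μ
    (isSetAlgebra_patternCylinders V A) (generateFrom_patternCylinders V A).symm
  have happ : ∀ m : M, ∃ E ∈ patternCylinders V A,
      μ.real (symmDiff (X ⁻¹' {m}) E) < δ / Fintype.card M := by
    intro m
    obtain ⟨E, hE, hlt⟩ := hdense.approx _ (hX m) (measure_ne_top _ _) (δ / Fintype.card M)
      (by positivity)
    refine ⟨E, hE, ?_⟩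
    rw [measureReal_def]
    exact ENNReal.toReal_lt_of_lt_ofReal hlt
  choose E hE hlt using happ
  choose D C hD hE using hE
  have hcyl : ∀ m, IsPatternCylinder (Finset.univ.biUnion D) (Finset.univ.biUnion C) (E m) :=
    fun m => (hE m).mono (Finset.subset_biUnion_of_mem D (Finset.mem_univ m))
      (Finset.subset_biUnion_of_mem C (Finset.mem_univ m))
  have hDm : ∀ s ∈ Finset.univ.biUnion D, MeasurableSet s := by
    intro s hs
    obtain ⟨m, -, hm⟩ := Finset.mem_biUnion.mp hs
    exact hD m s hm
  -- Outside the symmetric differences this set is exactly `{X z}`; the choice made elsewhere is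
  -- immaterial.
  let r : Set M → M := fun s => if h : s.Nonempty then h.some else X z₀
  let X' : (V → A) → M := fun z => r {m | z ∈ E m}
  have hfac : X'.FactorsThrough
      (fun z (u : ↥(Finset.univ.biUnion C)) => pattern (Finset.univ.biUnion D) (z u)) := by
    intro z z' hz
    have : {m | z ∈ E m} = {m | z' ∈ E m} :=
      Set.ext fun m => hcyl m z z' fun u hu => congrFun hz ⟨u, hu⟩
    simp only [X', this]
  have hmeas : HasMeasurableFibers X' := by
    have h := (hasMeasurableFibers_pattern_tuple hDm (Finset.univ.biUnion C)).comp
      (Function.extend (fun z (u : ↥(Finset.univ.biUnion C)) =>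
        pattern (Finset.univ.biUnion D) (z u)) X' fun _ => X z₀)
    simpa only [hfac.extend_apply] using h
  refine ⟨_, _, X', hDm, hfac, hmeas, ?_⟩
  have hsub : {z | X' z ≠ X z} ⊆ ⋃ m ∈ Finset.univ, symmDiff (X ⁻¹' {m}) (E m) := by
    intro z hz
    by_contra hn
    refine hz ?_
    have : {m | z ∈ E m} = {X z} := by
      ext m
      have : z ∉ symmDiff (X ⁻¹' {m}) (E m) := fun h => hn (Set.mem_biUnion (Finset.mem_univ m) h)
      simp only [Set.mem_symmDiff, Set.mem_preimage, Set.mem_singleton_iff,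
        Set.mem_ofPred_eq] at this ⊢
      grind
    simp only [X', this, r, Set.singleton_nonempty, dite_true]
    exact (Set.singleton_nonempty (X z)).some_mem
  calc μ.real {z | X' z ≠ X z} ≤ μ.real (⋃ m ∈ Finset.univ, symmDiff (X ⁻¹' {m}) (E m)) :=
        measureReal_mono hsub (measure_ne_top _ _)
    _ ≤ ∑ m, μ.real (symmDiff (X ⁻¹' {m}) (E m)) := measureReal_biUnion_finset_le _ _
    _ < ∑ _m : M, δ / Fintype.card M :=
        Finset.sum_lt_sum_of_nonempty ⟨X z₀, Finset.mem_univ _⟩ fun m _ => hlt m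
    _ = δ := by simp; field_simp

/-- Finitely many seeds, observed through finitely many sets, nearly determine `Y v`. -/
theorem exists_condEnt_pattern_lt {V A M : Type*} [DecidableEq V] [MeasurableSpace A]
    [Fintype M] (μ : Measure (V → A)) [IsProbabilityMeasure μ] {Y : V → (V → A) → M}
    (hY : ∀ v, HasMeasurableFibers (Y v)) (v : V) {ε : ℝ} (hε : 0 < ε) :
    ∃ (D : Finset (Set A)) (C : Finset V), (∀ s ∈ D, MeasurableSet s) ∧
      condEnt μ Y (fun u z => pattern D (z u)) {v} C < ε := by
  obtain ⟨δ, hδ, h⟩ := exists_ent_prodMk_sub_lt μ (hY v) hε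
  obtain ⟨D, C, X', hD, hfac, hX', hlt⟩ := exists_isPatternCylinder_approx μ (hY v) hδ
  refine ⟨D, C, hD, lt_of_le_of_lt ?_ (h X' hX' hlt)⟩
  have hW : ∀ u : V, HasMeasurableFibers fun z : V → A => pattern D (z u) := fun u a =>
    ((measurable_pattern hD).comp (measurable_pi_apply u)) (measurableSet_singleton a)
  have hU := hasMeasurableFibers_pattern_tuple (V := V) hD C
  -- Since `X'` is a function of the observed seeds, it drops out next to them, leaving `H(Y_v |
  -- W_C) ≤ H(Y_v | X')`.
  have hsub := ent_submodular μ X' (hY v) hU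
  have e1 : ent μ (fun z => (X' z, Y v z, fun u : C => pattern D (z u))) =
      famEnt μ (Sum.elim (fun v ω => (Sum.inl (Y v ω) : M ⊕ (D → Prop)))
        fun u z => Sum.inr (pattern D (z u))) (({v} : Finset V).disjSum C) := by
    refine ent_congr μ (hX'.prodMk ((hY v).prodMk hU))
      (HasMeasurableFibers.pi fun i => hasMeasurableFibers_sumElim hY hW i) fun z z' => ?_
    simp only [Prod.mk.injEq, funext_iff (α := ↥(({v} : Finset V).disjSum C)), Subtype.forall,
      Sum.forall, Finset.inl_mem_disjSum, Finset.inr_mem_disjSum, Sum.elim_inl, Sum.elim_inr,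
      Finset.mem_singleton, forall_eq, Sum.inl.injEq, Sum.inr.injEq]
    constructor
    · rintro ⟨-, h1, h2⟩
      exact ⟨h1, fun u hu => congrFun h2 ⟨u, hu⟩⟩
    · rintro ⟨h1, h2⟩
      have h3 : (fun u : C => pattern D (z u)) = fun u : C => pattern D (z' u) :=
        funext fun u => h2 u u.2
      exact ⟨hfac h3, h1, h3⟩
  have e2 : ent μ (fun z => (X' z, fun u : C => pattern D (z u))) =
      famEnt μ (fun u z => pattern D (z u)) C := by
    refine ent_congr μ (hX'.prodMk hU) hU fun z z' => ?_
    simp only [Prod.mk.injEq]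
    exact ⟨fun h => h.2, fun h => ⟨hfac h, h⟩⟩
  rw [e1, e2] at hsub
  unfold condEnt
  linarith

end FactorIID

/-! ### Spheres and automorphisms of the regular tree -/

namespace FactorIID

section Tree

variable {V : Type*} {T : SimpleGraph V}

theorem exists_adj_dist_eq_add_one (hT : T.Connected) {v x : V} (hx : x ≠ v) :
    ∃ p, T.Adj p x ∧ T.dist v x = T.dist v p + 1 := by
  obtain ⟨w, hw⟩ := hT.exists_walk_length_eq_dist x v
  cases w with
  | nil => exact absurd rfl hx
  | @cons _ p _ h q =>
    refine ⟨p, h.symm, ?_⟩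
    rw [SimpleGraph.Walk.length_cons] at hw
    have h1 := SimpleGraph.dist_le q
    have h2 : T.dist x v ≤ T.dist x p + T.dist p v := hT.dist_triangle
    rw [SimpleGraph.dist_eq_one_iff_adj.mpr h] at h2
    rw [T.dist_comm (u := v) (v := x), T.dist_comm (u := v) (v := p)]
    omega

/-- Geodesics to `p` and `p'`, prolonged to `x`, are both paths from `v` to `x`, hence equal. -/
theorem eq_of_adj_of_dist_eq_add_one (hT : T.IsTree) {v x p p' : V} (hp : T.Adj p x)
    (hd : T.dist v x = T.dist v p + 1) (hp' : T.Adj p' x)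
    (hd' : T.dist v x = T.dist v p' + 1) : p = p' := by
  obtain ⟨w, hw⟩ := hT.connected.exists_walk_length_eq_dist v p
  obtain ⟨w', hw'⟩ := hT.connected.exists_walk_length_eq_dist v p'
  have h : (w.concat hp).IsPath := SimpleGraph.Walk.isPath_of_length_eq_dist _ (by simp; omega)
  have h' : (w'.concat hp').IsPath :=
    SimpleGraph.Walk.isPath_of_length_eq_dist _ (by simp; omega)
  have := congrArg SimpleGraph.Walk.penultimate ((hT.existsUnique_path v x).unique h h')
  simpa using this

variable [T.LocallyFinite]

theorem mem_sphere {hT : T.Connected} {o v : V} {k : ℕ} :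
    v ∈ sphere T hT o k ↔ T.dist o v = k := by
  simp [sphere]

open Classical in
/-- The children of `p` when the tree is rooted at `v`. -/
noncomputable def children (T : SimpleGraph V) [T.LocallyFinite] (v p : V) : Finset V :=
  (T.neighborFinset p).filter fun x => T.dist v x = T.dist v p + 1

theorem mem_children {v p x : V} :
    x ∈ children T v p ↔ T.Adj p x ∧ T.dist v x = T.dist v p + 1 := by
  simp [children]

theorem card_children {d : ℕ} (hT : T.IsTree) (hreg : T.IsRegularOfDegree d) (v p : V) :
    (children T v p).card = if T.dist v p = 0 then d else d - 1 := by
  classical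
  have hdeg : (T.neighborFinset p).card = d := by
    rw [SimpleGraph.card_neighborFinset_eq_degree, hreg p]
  have hsplit := Finset.card_filter_add_card_filter_not (s := T.neighborFinset p)
    (fun x => T.dist v x = T.dist v p + 1)
  have hc : (children T v p).card =
    ((T.neighborFinset p).filter fun x => T.dist v x = T.dist v p + 1).card := by
    unfold children; congr
  rw [← hc, hdeg] at hsplit
  split_ifs with h0
  · have : ((T.neighborFinset p).filter fun x => ¬ T.dist v x = T.dist v p + 1) = ∅ := by
      refine Finset.filter_eq_empty_iff.mpr fun x hx hne => ?_
      rw [SimpleGraph.mem_neighborFinset] at hx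
      have := hT.dist_eq_dist_add_one_of_adj v hx
      omega
    rw [this, Finset.card_empty] at hsplit
    omega
  · obtain ⟨q, hq, hdq⟩ := exists_adj_dist_eq_add_one hT.connected (v := v) (x := p)
      (fun h => h0 (by rw [h, SimpleGraph.dist_self]))
    have : ((T.neighborFinset p).filter fun x => ¬ T.dist v x = T.dist v p + 1) = {q} := by
      ext x
      rw [Finset.mem_filter, SimpleGraph.mem_neighborFinset, Finset.mem_singleton]
      constructor
      · rintro ⟨hx, hne⟩
        have := hT.dist_eq_dist_add_one_of_adj v hx
        exact eq_of_adj_of_dist_eq_add_one hT hx.symm (by omega) hq hdq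
      · rintro rfl
        exact ⟨hq.symm, by omega⟩
    rw [this, Finset.card_singleton] at hsplit
    omega

theorem card_sphere_succ {d : ℕ} (hT : T.IsTree) (hreg : T.IsRegularOfDegree d) (v : V) (m : ℕ) :
    (sphere T hT.connected v (m + 1)).card =
      (sphere T hT.connected v m).card * (if m = 0 then d else d - 1) := by
  classical
  have h : sphere T hT.connected v (m + 1) =
      (sphere T hT.connected v m).biUnion (children T v) := by
    ext x
    simp only [Finset.mem_biUnion, mem_sphere, mem_children]
    constructor
    · intro hx
      obtain ⟨p, hp, hd⟩ := exists_adj_dist_eq_add_one hT.connected (v := v) (x := x)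
        (fun h => by rw [h, SimpleGraph.dist_self] at hx; omega)
      exact ⟨p, by omega, hp, hd⟩
    · rintro ⟨p, hp, -, hd⟩
      omega
  rw [h, Finset.card_biUnion, Finset.sum_const_nat]
  · intro p hp
    rw [card_children hT hreg, mem_sphere.mp hp]
  · intro p _ q _ hpq
    refine Finset.disjoint_left.mpr fun x hx hx' => hpq ?_
    rw [mem_children] at hx hx'
    exact eq_of_adj_of_dist_eq_add_one hT hx.1 hx.2 hx'.1 hx'.2

theorem card_sphere_eq {d : ℕ} (hT : T.IsTree) (hreg : T.IsRegularOfDegree d) (v o : V) (m : ℕ) :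
    (sphere T hT.connected v m).card = (sphere T hT.connected o m).card := by
  induction m with
  | zero =>
    have h : ∀ v, sphere T hT.connected v 0 = {v} := fun v => by
      ext x
      rw [mem_sphere, hT.connected.dist_eq_zero_iff, Finset.mem_singleton, eq_comm]
    rw [h, h, Finset.card_singleton, Finset.card_singleton]
  | succ m ih => rw [card_sphere_succ hT hreg, card_sphere_succ hT hreg, ih]

/-- Every step outwards multiplies the sphere by `d - 1`, except the step from radius `0`, where the
factor is `d`. -/
theorem pow_mul_card_sphere_le {d : ℕ} (hT : T.IsTree) (hreg : T.IsRegularOfDegree d) (v o : V)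
    (m k : ℕ) :
    (d - 1) ^ k * (sphere T hT.connected v m).card ≤ (sphere T hT.connected o (m + k)).card := by
  induction k with
  | zero => rw [pow_zero, one_mul, card_sphere_eq hT hreg v o m, add_zero]
  | succ k ih =>
    rw [← add_assoc, card_sphere_succ hT hreg, pow_succ, mul_right_comm]
    refine Nat.mul_le_mul ih ?_
    split_ifs <;> omega

/-- A bijection between finite sets of the same size can be chosen with a prescribed value. -/
theorem exists_bijOn_apply_eq {α : Type*} {s t : Finset α} (h : s.card = t.card) {a b : α}
    (ha : a ∈ s) (hb : b ∈ t) : ∃ f : α → α, Set.BijOn f s t ∧ f a = b := by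
  classical
  let e := s.equivOfCardEq h
  let e' := e.trans (Equiv.swap (e ⟨a, ha⟩) ⟨b, hb⟩)
  have hf : ∀ x (hx : x ∈ s), (fun x => if hx : x ∈ s then (e' ⟨x, hx⟩ : α) else x) x =
    e' ⟨x, hx⟩ := fun x hx => by simp [hx]
  refine ⟨fun x => if hx : x ∈ s then (e' ⟨x, hx⟩ : α) else x, ⟨?_, ?_, ?_⟩, ?_⟩
  · intro x hx
    rw [hf x hx]; exact (e' _).2
  · intro x hx y hy hxy
    rw [hf x hx, hf y hy] at hxy
    exact congrArg Subtype.val (e'.injective (Subtype.ext hxy))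
  · intro y hy
    refine ⟨e'.symm ⟨y, hy⟩, (e'.symm _).2, ?_⟩
    rw [hf _ (e'.symm _).2]; simp
  · rw [hf a ha]; simp [e']

/-- Meant for sets of children, with `p` and `q` saying that a child lies on the geodesic to a given
target; the bijection then matches the two geodesics. -/
theorem exists_bijOn_of_card_eq {α : Type*} {s t : Finset α} (h : s.card = t.card)
    (p q : α → Prop) : ∃ f : α → α, Set.BijOn f s t ∧
      ((∃ a ∈ s, p a) → (∃ b ∈ t, q b) → ∃ a ∈ s, p a ∧ q (f a)) := by
  by_cases hpq : (∃ a ∈ s, p a) ∧ ∃ b ∈ t, q b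
  · obtain ⟨⟨a, ha, hpa⟩, b, hb, hqb⟩ := hpq
    obtain ⟨f, hf, hab⟩ := exists_bijOn_apply_eq h ha hb
    exact ⟨f, hf, fun _ _ => ⟨a, ha, hpa, hab ▸ hqb⟩⟩
  · rcases s.eq_empty_or_nonempty with rfl | ⟨a, ha⟩
    · obtain rfl : t = ∅ := Finset.card_eq_zero.mp (by simpa using h.symm)
      exact ⟨id, by simp, fun h h' => absurd ⟨h, h'⟩ hpq⟩
    · obtain ⟨b, hb⟩ : t.Nonempty := Finset.card_pos.mp (h ▸ Finset.card_pos.mpr ⟨a, ha⟩)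
      obtain ⟨f, hf, -⟩ := exists_bijOn_apply_eq h ha hb
      exact ⟨f, hf, fun h h' => absurd ⟨h, h'⟩ hpq⟩

/-- Propagates a map from the root `v` to its descendants: `β p q` maps the children of `p`
to those of the image `q` of `p`. -/
def levelMap (v' : V) (par : V → V) (β : V → V → V → V) : ℕ → V → V
  | 0, _ => v'
  | n + 1, x => β (par x) (levelMap v' par β n (par x)) x

/-- A regular tree is distance-transitive. -/
theorem exists_iso_apply_eq {d : ℕ} (hT : T.IsTree) (hreg : T.IsRegularOfDegree d)
    {v z v' z' : V} (hd : T.dist v z = T.dist v' z') : ∃ γ : T ≃g T, γ v = v' ∧ γ z = z' := by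
  have hc := hT.connected
  have hpar : ∀ x, ∃ p, x ≠ v → T.Adj p x ∧ T.dist v x = T.dist v p + 1 := fun x => by
    by_cases hx : x = v
    · exact ⟨v, fun h => absurd hx h⟩
    · obtain ⟨p, hp⟩ := exists_adj_dist_eq_add_one hc hx
      exact ⟨p, fun _ => hp⟩
  choose par hpar using hpar
  have hβ : ∀ p q, ∃ f : V → V, T.dist v p = T.dist v' q →
      Set.BijOn f (children T v p) (children T v' q) ∧
      ((∃ a ∈ children T v p, T.dist v a + T.dist a z = T.dist v z) →
        (∃ b ∈ children T v' q, T.dist v' b + T.dist b z' = T.dist v' z') →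
        ∃ a ∈ children T v p, T.dist v a + T.dist a z = T.dist v z ∧
          T.dist v' (f a) + T.dist (f a) z' = T.dist v' z') := fun p q => by
    by_cases h : T.dist v p = T.dist v' q
    · obtain ⟨f, hf⟩ := exists_bijOn_of_card_eq (s := children T v p) (t := children T v' q)
        (by rw [card_children hT hreg, card_children hT hreg, h])
        (fun a => T.dist v a + T.dist a z = T.dist v z)
        (fun b => T.dist v' b + T.dist b z' = T.dist v' z')
      exact ⟨f, fun _ => hf⟩
    · exact ⟨id, fun h' => absurd h' h⟩
  choose β hβ using hβ
  let f : V → V := fun x => levelMap v' par β (T.dist v x) x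
  have hf0 : f v = v' := by
    change levelMap v' par β (T.dist v v) v = v'
    rw [SimpleGraph.dist_self]; rfl
  have hfs : ∀ p x, x ∈ children T v p → f x = β p (f p) x := by
    intro p x hx
    rw [mem_children] at hx
    have hxv : x ≠ v := by rintro rfl; rw [SimpleGraph.dist_self] at hx; omega
    have hp : par x = p :=
      eq_of_adj_of_dist_eq_add_one hT (hpar x hxv).1 (hpar x hxv).2 hx.1 hx.2
    change levelMap v' par β (T.dist v x) x = _
    rw [hx.2, levelMap, hp]
  have hmem : ∀ x, x ≠ v → x ∈ children T v (par x) := fun x hx => mem_children.mpr (hpar x hx)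
  have hdist : ∀ n x, T.dist v x = n → T.dist v' (f x) = n := by
    intro n
    induction n with
    | zero =>
      intro x hx
      rw [← (hc.dist_eq_zero_iff.mp hx), hf0, SimpleGraph.dist_self]
    | succ n ih =>
      intro x hx
      have hxv : x ≠ v := by rintro rfl; rw [SimpleGraph.dist_self] at hx; omega
      have hp : T.dist v (par x) = n := by have := (hpar x hxv).2; omega
      have h1 := ((hβ (par x) (f (par x)) (by rw [ih _ hp, hp])).1.mapsTo (hmem x hxv))
      rw [← hfs _ _ (hmem x hxv), Finset.mem_coe, mem_children, ih _ hp] at h1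
      exact h1.2
  have hbij : ∀ p, Set.BijOn f (children T v p) (children T v' (f p)) := fun p =>
    (hβ p (f p) (hdist _ p rfl).symm).1.congr fun x hx => (hfs p x hx).symm
  have hinj : ∀ n x y, T.dist v x = n → f x = f y → x = y := by
    intro n
    induction n with
    | zero =>
      intro x y hx hxy
      have h1 := hdist _ y rfl
      rw [← hxy, hdist _ x hx] at h1
      rw [← hc.dist_eq_zero_iff.mp hx, ← hc.dist_eq_zero_iff.mp h1.symm]
    | succ n ih =>
      intro x y hx hxy
      have hy : T.dist v y = n + 1 := by rw [← hdist _ y rfl, ← hxy, hdist _ x hx]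
      have hxv : x ≠ v := by rintro rfl; rw [SimpleGraph.dist_self] at hx; omega
      have hyv : y ≠ v := by rintro rfl; rw [SimpleGraph.dist_self] at hy; omega
      have h1 := mem_children.mp ((hbij (par x)).mapsTo (hmem x hxv))
      have h2 := mem_children.mp ((hbij (par y)).mapsTo (hmem y hyv))
      rw [hxy] at h1
      have h3 : par x = par y := ih _ _ (by have := (hpar x hxv).2; omega)
        (eq_of_adj_of_dist_eq_add_one hT h1.1 h1.2 h2.1 h2.2)
      exact (hbij (par y)).injOn (h3 ▸ hmem x hxv) (hmem y hyv) hxy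
  have hsurj : ∀ n y, T.dist v' y = n → ∃ x, f x = y := by
    intro n
    induction n with
    | zero => intro y hy; exact ⟨v, hf0.trans (hc.dist_eq_zero_iff.mp hy)⟩
    | succ n ih =>
      intro y hy
      obtain ⟨q, hq, hqd⟩ := exists_adj_dist_eq_add_one hc (v := v') (x := y)
        (by rintro rfl; rw [SimpleGraph.dist_self] at hy; omega)
      obtain ⟨p, rfl⟩ := ih q (by omega)
      obtain ⟨x, -, hx⟩ := (hbij p).surjOn (mem_children.mpr ⟨hq, hqd⟩)
      exact ⟨x, hx⟩
  -- Adjacent vertices of a tree lie on consecutive levels, so it suffices to compare parent-child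
  -- pairs.
  have hadj : ∀ x y, T.dist v' (f y) = T.dist v' (f x) + 1 → (T.Adj (f x) (f y) ↔ T.Adj x y) := by
    intro x y hxy
    have hxy' := hxy
    rw [hdist _ x rfl, hdist _ y rfl] at hxy'
    constructor
    · intro h
      have hyv : y ≠ v := by rintro rfl; rw [SimpleGraph.dist_self] at hxy'; omega
      have h1 := mem_children.mp ((hbij (par y)).mapsTo (hmem y hyv))
      have h2 := hinj _ _ _ rfl (eq_of_adj_of_dist_eq_add_one hT h hxy h1.1 h1.2)
      rw [h2]
      exact (hpar y hyv).1
    · intro h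
      exact (mem_children.mp ((hbij x).mapsTo (mem_children.mpr ⟨h, hxy'⟩))).1
  let γ : T ≃g T :=
    { toEquiv := Equiv.ofBijective f
        ⟨fun x y h => hinj _ x y rfl h, fun y => hsurj _ y rfl⟩
      map_rel_iff' := by
        intro x y
        change T.Adj (f x) (f y) ↔ T.Adj x y
        constructor
        · intro h
          rcases hT.dist_eq_dist_add_one_of_adj v' h with h' | h'
          · exact ((hadj y x h').mp h.symm).symm
          · exact (hadj x y h').mp h
        · intro h
          rcases hT.dist_eq_dist_add_one_of_adj v h with h' | h'
          · exact ((hadj y x (by rw [hdist _ x rfl, hdist _ y rfl, h'])).mpr h.symm).symm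
          · exact (hadj x y (by rw [hdist _ x rfl, hdist _ y rfl, h'])).mpr h }
  have hstep : ∀ {w t p : V}, T.dist w p + T.dist p t = T.dist w t → p ≠ t →
      ∃ a ∈ children T w p, T.dist w a + T.dist a t = T.dist w t := by
    intro w t p hp hne
    obtain ⟨a, ha, hda⟩ := exists_adj_dist_eq_add_one hc (v := t) hne
    have h1 : T.dist w t ≤ T.dist w a + T.dist a t := hc.dist_triangle
    have h2 : T.dist w a ≤ T.dist w p + T.dist p a := hc.dist_triangle
    rw [SimpleGraph.dist_eq_one_iff_adj.mpr ha.symm] at h2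
    rw [T.dist_comm (u := t), T.dist_comm (u := t)] at hda
    exact ⟨a, mem_children.mpr ⟨ha.symm, by omega⟩, by omega⟩
  -- The map carries the geodesic from `v` to `z` onto the one from `v'` to `z'`, level by level;
  -- the last level forces `f z = z'`.
  have hgeo : ∀ n ≤ T.dist v z, ∃ x, T.dist v x = n ∧ T.dist v x + T.dist x z = T.dist v z ∧
      T.dist v' (f x) + T.dist (f x) z' = T.dist v' z' := by
    intro n
    induction n with
    | zero => exact fun _ => ⟨v, by simp [hf0]⟩
    | succ n ih =>
      intro hn
      obtain ⟨p, hpn, hp, hp'⟩ := ih (by omega)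
      have hfp := hdist _ p hpn
      have hne : p ≠ z := by rintro rfl; omega
      have hne' : f p ≠ z' := by intro h; rw [h] at hfp; omega
      obtain ⟨a, ha, haz, haz'⟩ := (hβ p (f p) (by omega)).2 (hstep hp hne) (hstep hp' hne')
      rw [← hfs p a ha] at haz'
      exact ⟨a, by rw [(mem_children.mp ha).2, hpn], haz, haz'⟩
  refine ⟨γ, hf0, ?_⟩
  obtain ⟨x, hx, hxz, hxz'⟩ := hgeo _ le_rfl
  have h1 : x = z := hc.dist_eq_zero_iff.mp (by omega)
  subst h1
  have := hdist _ x rfl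
  exact hc.dist_eq_zero_iff.mp (show T.dist (f x) z' = 0 by omega)

end Tree

end FactorIID

/-! ### Chain rule along an ordering, and averaging over orderings -/

namespace FactorIID

section Averaging

variable {V : Type*} [DecidableEq V]

/-- The chain rule: adding the points of `C` in increasing order of `r` makes the sum telescope. -/
theorem sum_sub_insert_filter_lt (g : Finset V → ℝ) (r : V → ℕ) (C : Finset V)
    (hr : Set.InjOn r C) :
    ∑ z ∈ C, (g (C.filter (r · < r z)) - g (insert z (C.filter (r · < r z)))) = g ∅ - g C := by
  induction C using Finset.induction_on_max_value r with
  | empty => simp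
  | insert a s ha hmax ih =>
    have hlt : ∀ x ∈ s, r x < r a := fun x hx =>
      lt_of_le_of_ne (hmax x hx) fun h => ha (hr (by simp [hx]) (by simp) h ▸ hx)
    have h1 : (insert a s).filter (r · < r a) = s := by
      ext x; simp only [Finset.mem_filter, Finset.mem_insert]
      constructor
      · rintro ⟨rfl | hx, h⟩
        · exact absurd h (lt_irrefl _)
        · exact hx
      · exact fun hx => ⟨Or.inr hx, hlt x hx⟩
    have h2 : ∀ z ∈ s, (insert a s).filter (r · < r z) = s.filter (r · < r z) := fun z hz => by
      rw [Finset.filter_insert, if_neg (hlt z hz).le.not_gt]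
    rw [Finset.sum_insert ha, h1, Finset.sum_congr rfl fun z hz => by rw [h2 z hz],
      ih (hr.mono (by simp))]
    ring

/-- The rank of a vertex in an enumeration of `B`. -/
def rank {B : Finset V} (σ : B ≃ Fin B.card) (y : V) : ℕ :=
  if h : y ∈ B then σ ⟨y, h⟩ else 0

theorem rank_of_mem {B : Finset V} (σ : B ≃ Fin B.card) {y : V} (h : y ∈ B) :
    rank σ y = σ ⟨y, h⟩ := by
  simp [rank, h]

theorem injOn_rank {B : Finset V} (σ : B ≃ Fin B.card) : Set.InjOn (rank σ) B := by
  intro x hx y hy h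
  rw [rank_of_mem σ hx, rank_of_mem σ hy] at h
  exact congrArg Subtype.val (σ.injective (Fin.ext h))

/-- The members of `C` that precede `z`. -/
def before {B : Finset V} (σ : B ≃ Fin B.card) (C : Finset V) (z : V) : Finset V :=
  C.filter (rank σ · < rank σ z)

theorem notMem_before {B : Finset V} (σ : B ≃ Fin B.card) (C : Finset V) (z : V) :
    z ∉ before σ C z := by
  simp [before]

theorem before_mono {B : Finset V} (σ : B ≃ Fin B.card) {C C' : Finset V} (h : C ⊆ C') (z : V) :
    before σ C z ⊆ before σ C' z :=
  Finset.filter_subset_filter _ h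

/-- The law of the set of predecessors in a uniformly random order is equivariant. -/
theorem sum_before_map {B C : Finset V} (e : V ↪ V) (hC : C ⊆ B) (hC' : C.map e ⊆ B) {z : V}
    (hz : z ∈ C) (φ φ' : Finset V → ℝ) (h : ∀ A, φ' (A.map e) = φ A) :
    ∑ σ : B ≃ Fin B.card, φ' (before σ (C.map e) (e z)) =
      ∑ σ : B ≃ Fin B.card, φ (before σ C z) := by
  let ε : {x : B // (x : V) ∈ C} ≃ {x : B // (x : V) ∈ C.map e} :=
    Equiv.ofBijective
      (fun x => ⟨⟨e x, hC' (Finset.mem_map_of_mem e x.2)⟩, Finset.mem_map_of_mem e x.2⟩) <| by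
      constructor
      · intro x y hxy
        simp only [Subtype.mk.injEq, e.injective.eq_iff] at hxy
        exact Subtype.ext (Subtype.ext hxy)
      · rintro ⟨⟨y, hy⟩, hy'⟩
        obtain ⟨x, hx, rfl⟩ := Finset.mem_map.mp hy'
        exact ⟨⟨⟨x, hC hx⟩, hx⟩, rfl⟩
  -- The map `e` need not preserve `B`, but its restriction to `C` extends to a permutation of `B`,
  -- along which the orderings are reindexed.
  let τ : Equiv.Perm B := ε.extendSubtype
  have hτ : ∀ x (hx : x ∈ C), τ ⟨x, hC hx⟩ = ⟨e x, hC' (Finset.mem_map_of_mem e hx)⟩ :=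
    fun x hx => Equiv.extendSubtype_apply_of_mem ε ⟨x, hC hx⟩ hx
  rw [← Equiv.sum_comp (Equiv.equivCongr τ.symm (Equiv.refl (Fin B.card)))
    fun σ => φ (before σ C z)]
  refine Finset.sum_congr rfl fun σ _ => ?_
  rw [← h]
  congr 1
  have hrank : ∀ x ∈ C, rank (Equiv.equivCongr τ.symm (Equiv.refl (Fin B.card)) σ) x =
      rank σ (e x) := fun x hx => by
    rw [rank_of_mem _ (hC hx), rank_of_mem _ (hC' (Finset.mem_map_of_mem e hx)), ← hτ x hx]
    simp
  ext y
  simp only [before, Finset.mem_filter, Finset.mem_map]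
  constructor
  · rintro ⟨⟨x, hx, rfl⟩, hlt⟩
    exact ⟨x, ⟨hx, by rwa [hrank x hx, hrank z hz]⟩, rfl⟩
  · rintro ⟨x, ⟨hx, hlt⟩, rfl⟩
    rw [hrank x hx, hrank z hz] at hlt
    exact ⟨⟨x, hx, rfl⟩, hlt⟩

end Averaging

/-! ### The growth inequality on the tree -/

section Tree

variable {V : Type*} {T : SimpleGraph V}

theorem dist_iso_apply (hT : T.Connected) (γ : T ≃g T) (u v : V) :
    T.dist (γ u) (γ v) = T.dist u v := by
  have h : ∀ (γ : T ≃g T) (u v : V), T.dist (γ u) (γ v) ≤ T.dist u v := fun γ u v => by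
    obtain ⟨w, hw⟩ := hT.exists_walk_length_eq_dist u v
    rw [← hw, ← SimpleGraph.Walk.length_map (γ : T →g T) w]
    exact SimpleGraph.dist_le _
  refine le_antisymm (h γ u v) ?_
  simpa using h γ.symm (γ u) (γ v)

theorem exists_dist_eq_of_dist_eq_add (hT : T.Connected) {o : V} {k : ℕ} (m : ℕ) (z : V)
    (h : T.dist o z = m + k) : ∃ v, T.dist o v = k ∧ T.dist v z = m := by
  induction m generalizing z with
  | zero => exact ⟨z, by omega, SimpleGraph.dist_self⟩
  | succ m ih =>
    obtain ⟨p, hp, hd⟩ := exists_adj_dist_eq_add_one hT (v := o) (x := z)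
      (by rintro rfl; rw [SimpleGraph.dist_self] at h; omega)
    obtain ⟨v, hv, hvp⟩ := ih p (by omega)
    refine ⟨v, hv, ?_⟩
    have h1 : T.dist v z ≤ T.dist v p + T.dist p z := hT.dist_triangle
    have h2 : T.dist o z ≤ T.dist o v + T.dist v z := hT.dist_triangle
    rw [SimpleGraph.dist_eq_one_iff_adj.mpr hp] at h1
    omega

variable [T.LocallyFinite]

open Classical in
/-- The closed ball of radius `n` around `v`. -/
noncomputable def closedBall (T : SimpleGraph V) [T.LocallyFinite] (hT : T.Connected) (v : V)
    (n : ℕ) : Finset V :=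
  (Finset.range (n + 1)).biUnion (sphere T hT v)

theorem mem_closedBall {hT : T.Connected} {v x : V} {n : ℕ} :
    x ∈ closedBall T hT v n ↔ T.dist v x ≤ n := by
  simp [closedBall, mem_sphere]

theorem map_closedBall (hT : T.Connected) (γ : T ≃g T) (v : V) (n : ℕ) :
    (closedBall T hT v n).map γ.toEquiv.toEmbedding = closedBall T hT (γ v) n := by
  ext x
  obtain ⟨y, rfl⟩ := γ.surjective x
  have : γ y = γ.toEquiv.toEmbedding y := rfl
  rw [this, Finset.mem_map', mem_closedBall, mem_closedBall, ← this, dist_iso_apply hT]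

variable [DecidableEq V]

/-- The growth inequality for a conditional-entropy-like functional `G` of finite vertex sets
(`G S C` playing the role of the entropy of `S` given the seeds in `C`). -/
theorem pow_mul_sub_le_of_isTree {d : ℕ} (hd : 2 ≤ d) (hT : T.IsTree)
    (hreg : T.IsRegularOfDegree d)
    (G : Finset V → Finset V → ℝ) (hG : ∀ S C, 0 ≤ G S C)
    (hanti : ∀ S {C C'}, C ⊆ C' → G S C' ≤ G S C)
    (hdiff : ∀ {S S' C C' z}, S ⊆ S' → C ⊆ C' → z ∉ C' →
      G S C - G S (insert z C) ≤ G S' C' - G S' (insert z C'))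
    (hinv : ∀ (γ : T ≃g T) S C,
      G (S.map γ.toEquiv.toEmbedding) (C.map γ.toEquiv.toEmbedding) = G S C)
    (k n : ℕ) (o v : V) :
    ((d : ℝ) - 1) ^ k * (G {v} ∅ - G {v} (closedBall T hT.connected v n)) ≤
      G (sphere T hT.connected o k) ∅ := by
  have hc := hT.connected
  set S := sphere T hc o k with hS
  -- This ball contains the `n`-balls around all points of `S`, so orderings of one finite set serve
  -- them all.
  set B := closedBall T hc o (n + k) with hB
  have hdisj : ∀ (o : V) (k : ℕ), Set.PairwiseDisjoint (Finset.range (n + 1) : Set ℕ)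
      fun m => sphere T hc o (m + k) := fun o k m _ m' _ hmm => by
    refine Finset.disjoint_left.mpr fun x hx hx' => hmm ?_
    rw [mem_sphere] at hx hx'
    omega
  have hball : ∀ u ∈ S, closedBall T hc u n ⊆ B := fun u hu x hx => by
    rw [hS, mem_sphere] at hu
    rw [mem_closedBall] at hx
    rw [hB, mem_closedBall]
    have : T.dist o x ≤ T.dist o u + T.dist u x := hc.dist_triangle
    omega
  -- `I` is the information about `S` gained from `z` after its predecessors in `C`. `J` sums it
  -- over all orderings without normalising, whence the factor `Q` below.
  let I : Finset V → Finset V → V → (B ≃ Fin B.card) → ℝ := fun S C z σ =>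
    G S (before σ C z) - G S (insert z (before σ C z))
  let J : V → V → ℝ := fun u z => ∑ σ, I {u} (closedBall T hc u n) z σ
  have hI : ∀ S C z σ, 0 ≤ I S C z σ := fun S C z σ =>
    sub_nonneg.mpr (hanti S (Finset.subset_insert _ _))
  have htel : ∀ S C σ, C ⊆ B → ∑ z ∈ C, I S C z σ = G S ∅ - G S C := fun S C σ hCB =>
    sum_sub_insert_filter_lt (G S) (rank σ) C ((injOn_rank σ).mono hCB)
  have hJ : ∀ u ∈ S, ∀ u' ∈ S, ∀ z z', T.dist u z = T.dist u' z' → T.dist u z ≤ n →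
      J u z = J u' z' := by
    intro u hu u' hu' z z' hzz hz
    obtain ⟨γ, rfl, rfl⟩ := exists_iso_apply_eq hT hreg hzz
    have := sum_before_map (B := B) γ.toEquiv.toEmbedding (hball u hu)
      (by rw [map_closedBall]; exact hball _ hu') (mem_closedBall.mpr hz)
      (fun A => G {u} A - G {u} (insert z A)) (fun A => G {γ u} A - G {γ u} (insert (γ z) A))
      (fun A => by
        have h1 := hinv γ {u} A
        have h2 := hinv γ {u} (insert z A)
        rw [Finset.map_singleton] at h1 h2
        rw [Finset.map_insert] at h2
        exact congrArg₂ _ h1 h2)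
    rw [map_closedBall] at this
    exact this.symm
  obtain ⟨j, hj0, hj⟩ : ∃ j : ℕ → ℝ, (∀ m, 0 ≤ j m) ∧
      ∀ m ≤ n, ∀ u ∈ S, ∀ z, T.dist u z = m → J u z = j m := by
    classical
    refine ⟨fun m => if h : ∃ x : V × V, x.1 ∈ S ∧ T.dist x.1 x.2 = m then
      J h.choose.1 h.choose.2 else 0, fun m => ?_, fun m hm u hu z hz => ?_⟩
    · beta_reduce
      split_ifs
      · exact Finset.sum_nonneg fun σ _ => hI _ _ _ _
      · exact le_rfl
    · have h : ∃ x : V × V, x.1 ∈ S ∧ T.dist x.1 x.2 = m := ⟨(u, z), hu, hz⟩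
      simp only [dif_pos h]
      exact hJ u hu _ h.choose_spec.1 _ _ (hz.trans h.choose_spec.2.symm) (by omega)
  set Q : ℝ := (Fintype.card (B ≃ Fin B.card) : ℝ) with hQ
  have hQ0 : 0 < Q := by
    have : Nonempty (B ≃ Fin B.card) := ⟨B.equivFin⟩
    rw [hQ]; exact_mod_cast Fintype.card_pos
  have hupper : ∑ m ∈ Finset.range (n + 1), ((sphere T hc o (m + k)).card : ℝ) * j m ≤
      Q * G S ∅ := by
    calc ∑ m ∈ Finset.range (n + 1), ((sphere T hc o (m + k)).card : ℝ) * j m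
        ≤ ∑ m ∈ Finset.range (n + 1), ∑ z ∈ sphere T hc o (m + k), ∑ σ, I S B z σ := by
          refine Finset.sum_le_sum fun m hm => ?_
          rw [← nsmul_eq_mul, ← Finset.sum_const]
          refine Finset.sum_le_sum fun z hz => ?_
          obtain ⟨u, hu, huz⟩ := exists_dist_eq_of_dist_eq_add hc m z (mem_sphere.mp hz)
          have huS : u ∈ S := by rw [hS, mem_sphere]; exact hu
          -- Enlarging `{u}` to `S` and the ball around `u` to `B` can only increase the
          -- contribution of `z`.
          rw [← hj m (by simpa [Nat.lt_succ_iff] using hm) u huS z huz]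
          exact Finset.sum_le_sum fun σ _ => hdiff (Finset.singleton_subset_iff.mpr huS)
            (before_mono σ (hball u huS) z) (notMem_before σ B z)
      _ = ∑ z ∈ (Finset.range (n + 1)).biUnion (fun m => sphere T hc o (m + k)),
            ∑ σ, I S B z σ := (Finset.sum_biUnion (hdisj o k)).symm
      _ ≤ ∑ z ∈ B, ∑ σ, I S B z σ := by
          refine Finset.sum_le_sum_of_subset_of_nonneg (fun x hx => ?_)
            fun z _ _ => Finset.sum_nonneg fun σ _ => hI _ _ _ _
          obtain ⟨m, hm, hx⟩ := Finset.mem_biUnion.mp hx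
          rw [Finset.mem_range] at hm
          rw [mem_sphere] at hx
          rw [hB, mem_closedBall]
          omega
      _ = ∑ σ : B ≃ Fin B.card, (G S ∅ - G S B) := by
          rw [Finset.sum_comm]
          exact Finset.sum_congr rfl fun σ _ => htel S B σ subset_rfl
      _ ≤ Q * G S ∅ := by
          rw [Finset.sum_const, nsmul_eq_mul, Finset.card_univ]
          exact mul_le_mul_of_nonneg_left (sub_le_self _ (hG S B)) hQ0.le
  obtain ⟨u, hu⟩ : S.Nonempty := by
    have h0 : 0 < (sphere T hc o 0).card :=
      Finset.card_pos.mpr ⟨o, mem_sphere.mpr SimpleGraph.dist_self⟩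
    have hpos : 0 < (d - 1) ^ k := pow_pos (by omega) k
    rw [← Finset.card_pos, hS, ← zero_add k]
    exact (Nat.mul_pos hpos h0).trans_le (pow_mul_card_sphere_le hT hreg o o 0 k)
  have hlower : ∑ m ∈ Finset.range (n + 1), ((sphere T hc u m).card : ℝ) * j m =
      Q * (G {u} ∅ - G {u} (closedBall T hc u n)) := by
    calc ∑ m ∈ Finset.range (n + 1), ((sphere T hc u m).card : ℝ) * j m
        = ∑ m ∈ Finset.range (n + 1), ∑ z ∈ sphere T hc u m, J u z := by
          refine Finset.sum_congr rfl fun m hm => ?_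
          rw [← nsmul_eq_mul, ← Finset.sum_const]
          refine Finset.sum_congr rfl fun z hz => ?_
          exact (hj m (by simpa [Nat.lt_succ_iff] using hm) u hu z (mem_sphere.mp hz)).symm
      _ = ∑ z ∈ closedBall T hc u n, J u z := by
          have h : closedBall T hc u n = (Finset.range (n + 1)).biUnion (sphere T hc u) := by
            ext x
            simp [mem_closedBall, mem_sphere]
          rw [h, Finset.sum_biUnion (by simpa using hdisj u 0)]
      _ = Q * (G {u} ∅ - G {u} (closedBall T hc u n)) := by
          rw [Finset.sum_comm, Finset.sum_congr rfl fun σ _ => htel {u} _ σ (hball u hu),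
            Finset.sum_const, nsmul_eq_mul, Finset.card_univ]
  have hvu : G {v} ∅ - G {v} (closedBall T hc v n) = G {u} ∅ - G {u} (closedBall T hc u n) := by
    obtain ⟨γ, rfl, -⟩ := exists_iso_apply_eq hT hreg (v := u) (z := u) (v' := v) (z' := v)
      (by simp)
    have h1 := hinv γ {u} ∅
    have h2 := hinv γ {u} (closedBall T hc u n)
    rw [Finset.map_singleton, Finset.map_empty] at h1
    rw [Finset.map_singleton, map_closedBall] at h2
    exact (congrArg₂ (· - ·) h1 h2)
  have hd1 : ((d : ℝ) - 1) = ((d - 1 : ℕ) : ℝ) := by push_cast [Nat.cast_sub (show 1 ≤ d by omega)]; ring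
  rw [hvu]
  refine le_of_mul_le_mul_left ?_ hQ0
  calc Q * (((d : ℝ) - 1) ^ k * (G {u} ∅ - G {u} (closedBall T hc u n)))
      = ((d : ℝ) - 1) ^ k * ∑ m ∈ Finset.range (n + 1), ((sphere T hc u m).card : ℝ) * j m := by
        rw [hlower]; ring
    _ ≤ ∑ m ∈ Finset.range (n + 1), ((sphere T hc o (m + k)).card : ℝ) * j m := by
        rw [Finset.mul_sum]
        refine Finset.sum_le_sum fun m _ => ?_
        rw [← mul_assoc, hd1]
        refine mul_le_mul_of_nonneg_right ?_ (hj0 m)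
        exact_mod_cast pow_mul_card_sphere_le hT hreg u o m k
    _ ≤ Q * G S ∅ := hupper

end Tree

end FactorIID

/-! ### Passage to the law of the seeds and conclusion -/

open FactorIID in
theorem FactorIID.jointEntropy_eq_famEnt {V M Ω : Type*} [DecidableEq V] [Fintype M]
    [MeasurableSpace M] [DiscreteMeasurableSpace M] [MeasurableSpace Ω] (P : Measure Ω)
    {Y : V → Ω → M} (hY : ∀ v, Measurable (Y v)) (S : Finset V) :
    jointEntropy P Y S = famEnt P Y S := by
  have hm : Measurable fun (ω : Ω) (v : S) => Y v ω := measurable_pi_lambda _ fun v => hY v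
  unfold jointEntropy shannonEntropy famEnt ent
  have h : ∀ a : S → M, (P.map fun (ω : Ω) (v : S) => Y v ω).real {a} =
      P.real ((fun (ω : Ω) (v : S) => Y v ω) ⁻¹' {a}) := fun a =>
    map_measureReal_apply hm (measurableSet_singleton a)
  simp only [h]
  congr!

/-- Relabelling the vertices preserves the law of an IID process. -/
theorem FactorIID.IsIIDProcess.measurePreserving_comp {V A Ω : Type*} [MeasurableSpace A]
    [MeasurableSpace Ω] {P : Measure Ω} [IsProbabilityMeasure P] {Z : V → Ω → A}
    (hZ : FactorIID.IsIIDProcess P Z) (e : V ≃ V) :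
    MeasurePreserving (fun (z : V → A) v => z (e v)) (P.map fun ω v => Z v ω)
      (P.map fun ω v => Z v ω) := by
  obtain ⟨hm, hind, hid⟩ := hZ
  have hme : Measurable fun (z : V → A) v => z (e v) :=
    measurable_pi_lambda _ fun v => measurable_pi_apply _
  have hmZ : Measurable fun ω v => Z v ω := measurable_pi_lambda _ hm
  refine ⟨hme, ?_⟩
  rw [Measure.map_map hme hmZ]
  change P.map (fun ω v => Z (e v) ω) = _
  rw [(hind.precomp e.injective).map_fun_eq_infinitePi_map fun v => hm (e v),
    hind.map_fun_eq_infinitePi_map hm]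
  congr 1
  ext1 v
  exact (hid (e v) v).map_eq

theorem FactorIID.IsIIDProcess.iIndepFun_comp_eval {V A K Ω : Type*} [MeasurableSpace A]
    [MeasurableSpace K] [MeasurableSpace Ω] {P : Measure Ω} [IsProbabilityMeasure P]
    {Z : V → Ω → A} (hZ : FactorIID.IsIIDProcess P Z) {f : A → K} (hf : Measurable f) :
    iIndepFun (fun v (z : V → A) => f (z v)) (P.map fun ω v => Z v ω) := by
  obtain ⟨hm, hind, -⟩ := hZ
  have (v : V) : IsProbabilityMeasure (P.map (Z v)) :=
    Measure.isProbabilityMeasure_map (hm v).aemeasurable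
  rw [hind.map_fun_eq_infinitePi_map hm]
  exact iIndepFun_infinitePi fun _ => hf

open FactorIID in
theorem mainTheorem3 {V A M Ω : Type*} (d : ℕ) (hd : 3 ≤ d)
    (T : SimpleGraph V) [T.LocallyFinite] (hT : T.IsTree) (hreg : T.IsRegularOfDegree d)
    [MeasurableSpace A] [Fintype M] [MeasurableSpace M] [DiscreteMeasurableSpace M]
    [MeasurableSpace Ω] (P : Measure Ω) [IsProbabilityMeasure P]
    (Z : V → Ω → A) (hZ : FactorIID.IsIIDProcess P Z)
    (Y : V → Ω → M) (hY : FactorIID.IsAutFactorOf T Z Y)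
    (k : ℕ) (o v : V) :
    ((d : ℝ) - 1) ^ k * FactorIID.jointEntropy P Y {v} ≤
      FactorIID.jointEntropy P Y (FactorIID.sphere T hT.connected o k) := by
  classical
  obtain ⟨F, ⟨hF, hequiv⟩, hYF⟩ := hY
  obtain rfl : Y = fun v ω => F (fun u => Z u ω) v := funext fun v => funext fun ω => hYF v ω
  have hmZ : Measurable fun ω v => Z v ω := measurable_pi_lambda _ hZ.1
  have hmF : ∀ v, Measurable fun z => F z v := fun v => (measurable_pi_apply v).comp hF
  -- On the space of labellings, unlike on `Ω`, automorphisms act as measure-preserving maps.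
  set μ := P.map fun ω v => Z v ω with hμ
  have : IsProbabilityMeasure μ := Measure.isProbabilityMeasure_map hmZ.aemeasurable
  have hYm : ∀ v, HasMeasurableFibers fun z => F z v := fun v a =>
    hmF v (measurableSet_singleton a)
  have hent : ∀ S, jointEntropy P (fun v ω => F (fun u => Z u ω) v) S =
      famEnt μ (fun v z => F z v) S := fun S => by
    rw [← jointEntropy_eq_famEnt μ hmF]
    unfold jointEntropy
    rw [hμ, Measure.map_map (g := fun z (v : S) => F z v)
      (measurable_pi_lambda _ fun v => hmF v) hmZ]
    rfl
  rw [hent, hent]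
  refine le_of_forall_pos_le_add fun ε hε => ?_
  have hpow : 0 < ((d : ℝ) - 1) ^ k := by
    have : (3 : ℝ) ≤ d := by exact_mod_cast hd
    exact pow_pos (by linarith) k
  -- The residual entropy gets multiplied by `(d-1)^k`, hence the tolerance `ε / (d-1)^k`.
  obtain ⟨D, C, hD, hlt⟩ := exists_condEnt_pattern_lt μ hYm v (div_pos hε hpow)
  have hpm := measurable_pattern hD
  have hW : ∀ u : V, Measurable fun z : V → A => pattern D (z u) := fun u =>
    hpm.comp (measurable_pi_apply u)
  have hW' : ∀ u : V, HasMeasurableFibers fun z : V → A => pattern D (z u) := fun u a =>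
    hW u (measurableSet_singleton a)
  obtain ⟨n, hn⟩ : ∃ n, C ⊆ closedBall T hT.connected v n :=
    ⟨C.sup (T.dist v), fun x hx => mem_closedBall.mpr (Finset.le_sup (f := T.dist v) hx)⟩
  have hmain := pow_mul_sub_le_of_isTree (by omega) hT hreg
    (condEnt μ (fun v z => F z v) fun u z => pattern D (z u))
    (condEnt_nonneg μ hYm hW') (fun S _ _ h => condEnt_anti μ hYm hW' S h)
    (fun hS hC hz => condEnt_sub_insert_le μ hYm hW (hZ.iIndepFun_comp_eval hpm) hS hC hz)
    -- Equivariance under `γ⁻¹` reads `F z (γ v) = F (z ∘ γ) v`.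
    (fun γ S C => condEnt_map μ hYm hW' (hZ.measurePreserving_comp γ.toEquiv) _
      (fun v z => (congrFun (hequiv γ.symm z) v).symm) (fun _ _ => rfl) S C) k n o v
  rw [condEnt_empty_right μ hYm hW', condEnt_empty_right μ hYm hW'] at hmain
  have hsmall := (condEnt_anti μ hYm hW' {v} hn).trans hlt.le
  rw [le_div_iff₀' hpow] at hsmall
  rw [mul_sub] at hmain
  linarith
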